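/- Let $d\ge 1$ and let $\nu$ be a probability measure on $\mathbb R$ that is absolutely continuous with a bounded, compactly supported density $\rho$ (i.e. $\nu(B)=\int_B\rho(v)\,dv$ for Borel $B\subset\mathbb R$, with $\rho\in L^\infty(\mathbb R)$ of compact support). Let $\omega=(\omega_n)_{n\in\mathbb Z^d}$ be independent real random variables with common distribution $\nu$. For $\lambda>0$ let $$(h_{\omega,\lambda}u)(n)=-\sum_{k\in\mathbb Z^d,\,|k|=1}u(n+k)+\lambda\,\omega_n u(n),\qquad n\in\mathbb Z^d,$$ be the Anderson Hamiltonian, a self-adjoint operator on $\ell^2(\mathbb Z^d)$ with domain $\{u:\sum_n|\omega_nu(n)|^2<\infty\}$, where $|k|=|k_1|+\dots+|k_d|$. For $x,y\in\mathbb Z^d$ and $z\in\mathbb C\setminus\mathbb R$ let $$G_{\omega,\lambda}(x,y;z)=\langle e_x,(h_{\omega,\lambda}-z)^{-1}e_y\rangle$$ be its Green function, where $(e_x)_{x\in\mathbb Z^d}$ is the canonical basis of $\ell^2(\mathbb Z^d)$. Let $0<s<1$. Then there exists $\lambda_0>0$, depending only on $d$, $\rho$ and $s$, such that for every $\lambda\ge\lambda_0$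 there are constants $C<\infty$ and $\mu>0$, depending only on $d$, $\rho$, $s$ and $\lambda$, with $$\mathbb E\left(|G_{\omega,\lambda}(x,y;z)|^s\right)\le C e^{-\mu|x-y|}$$ for all $x,y\in\mathbb Z^d$ and all $z\in\mathbb C\setminus\mathbb R$. -/

import Mathlib

open MeasureTheory ProbabilityTheory
open scoped ENNReal

namespace Anderson

/-- The Hilbert space `ℓ²(ℤ^d)` of square-summable functions `ℤ^d → ℂ`. -/
abbrev Ell2 (d : ℕ) : Type := lp (fun _ : Fin d → ℤ => ℂ) 2

noncomputable section

/-- The graph distance `|n| = |n₁| + ... + |n_d|` of `n ∈ ℤ^d` from the origin. -/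
def latticeNorm {d : ℕ} (n : Fin d → ℤ) : ℤ := ∑ i, |n i|

/-- The finite set of all `k ∈ ℤ^d` with `|k| = 1`
(see `mem_unitVectors`; all entries of such a `k` lie in `{-1, 0, 1}`). -/
def unitVectors (d : ℕ) : Finset (Fin d → ℤ) :=
  (Fintype.piFinset fun _ => Finset.Icc (-1 : ℤ) 1).filter fun k => latticeNorm k = 1

theorem mem_unitVectors {d : ℕ} (k : Fin d → ℤ) :
    k ∈ unitVectors d ↔ latticeNorm k = 1 := by
  simp only [unitVectors, Finset.mem_filter, Fintype.mem_piFinset, Finset.mem_Icc,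
    and_iff_right_iff_imp]
  intro h i
  have h1 : |k i| ≤ ∑ j, |k j| :=
    Finset.single_le_sum (f := fun j => |k j|) (fun j _ => abs_nonneg _) (Finset.mem_univ i)
  have h2 : |k i| ≤ 1 := h1.trans h.le
  exact abs_le.mp h2

theorem memℓp_shift {d : ℕ} (u : Ell2 d) (k : Fin d → ℤ) :
    Memℓp (fun n : Fin d → ℤ => (u (n + k) : ℂ)) 2 := by
  have h := (memℓp_gen_iff (p := 2) (by norm_num)).1 (lp.memℓp u)
  refine (memℓp_gen_iff (p := 2) (by norm_num)).2 ?_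
  exact (Equiv.addRight k).summable_iff.2 h

theorem memℓp_laplacian {d : ℕ} (u : Ell2 d) :
    Memℓp (fun n : Fin d → ℤ => (-∑ k ∈ unitVectors d, u (n + k) : ℂ)) 2 := by
  have h : Memℓp (fun n : Fin d → ℤ => (∑ k ∈ unitVectors d, u (n + k) : ℂ)) 2 :=
    Memℓp.finsetSum (unitVectors d) (f := fun k n => (u (n + k) : ℂ))
      fun k _ => memℓp_shift u k
  exact h.neg

/-- The discrete Laplacian `(h₀ u)(n) = -∑_{|k| = 1} u(n + k)` on `ℓ²(ℤ^d)`. -/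
def laplacian (d : ℕ) : Ell2 d →ₗ[ℂ] Ell2 d where
  toFun u := ⟨fun n => -∑ k ∈ unitVectors d, u (n + k), memℓp_laplacian u⟩
  map_add' u v := by
    ext n
    change -∑ k ∈ unitVectors d, (u (n + k) + v (n + k)) =
      -∑ k ∈ unitVectors d, u (n + k) + -∑ k ∈ unitVectors d, v (n + k)
    rw [Finset.sum_add_distrib, neg_add]
  map_smul' c u := by
    ext n
    simp [Finset.mul_sum]

/-- The domain `{u ∈ ℓ²(ℤ^d) : ∑ |v(n) u(n)|² < ∞}` of the maximal operator of
multiplication by the potential `v : ℤ^d → ℝ`. -/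
def potentialDomain {d : ℕ} (v : (Fin d → ℤ) → ℝ) : Submodule ℂ (Ell2 d) where
  carrier := {u | Memℓp (fun n => (v n : ℂ) * u n) 2}
  zero_mem' := by
    have h : Memℓp (fun _ : Fin d → ℤ => (0 : ℂ)) 2 := zero_memℓp
    simpa using h
  add_mem' {a b} ha hb := by
    have h := Memℓp.add ha hb
    simpa [mul_add, Pi.add_def] using h
  smul_mem' c a ha := by
    have h := Memℓp.const_smul ha c
    simpa [Pi.smul_def, mul_left_comm] using h

/-- The maximal operator of multiplication by the potential `v`. -/
def potential {d : ℕ} (v : (Fin d → ℤ) → ℝ) : Ell2 d →ₗ.[ℂ] Ell2 d where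
  domain := potentialDomain v
  toFun :=
    { toFun := fun u => ⟨fun n => (v n : ℂ) * u.1 n, u.2⟩
      map_add' := fun a b => by
        ext n
        exact mul_add (v n : ℂ) (a.1 n) (b.1 n)
      map_smul' := fun c a => by
        ext n
        simp [mul_left_comm] }

/-- The Schrödinger operator `h₀ + v`, with domain the domain of multiplication by `v`
(all of `ℓ²(ℤ^d)` if `v` is bounded). -/
def schrodinger {d : ℕ} (v : (Fin d → ℤ) → ℝ) : Ell2 d →ₗ.[ℂ] Ell2 d :=
  laplacian d +ᵥ potential v

/-- The Anderson Hamiltonian `h_{ω,lam} = h₀ + lam V_ω` with `V_ω(n) = ω_n`, at disorder `lam`. -/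
def hamiltonian {d : ℕ} (lam : ℝ) (ω : (Fin d → ℤ) → ℝ) : Ell2 d →ₗ.[ℂ] Ell2 d :=
  schrodinger fun n => lam * ω n

open Classical in
/-- `(T - z)⁻¹ f`: the vector `u` in the domain of `T` with `T u - z u = f`.
It exists and is unique if `T` is self-adjoint and `z` is not real. -/
def resolventApply {d : ℕ} (T : Ell2 d →ₗ.[ℂ] Ell2 d) (z : ℂ) (f : Ell2 d) :
    Ell2 d :=
  if h : ∃ u : T.domain, T u - z • (u : Ell2 d) = f then (h.choose : Ell2 d) else 0

/-- The canonical basis vector `e_x` of `ℓ²(ℤ^d)`. -/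
def basisVec {d : ℕ} (x : Fin d → ℤ) : Ell2 d := lp.single 2 x (1 : ℂ)

/-- The Green function `G_{ω,lam}(x, y; z) = ⟨e_x, (h_{ω,lam} - z)⁻¹ e_y⟩`
(the inner product is linear in the second argument). -/
def green {d : ℕ} (lam : ℝ) (ω : (Fin d → ℤ) → ℝ) (x y : Fin d → ℤ) (z : ℂ) : ℂ :=
  inner ℂ (basisVec x) (resolventApply (hamiltonian lam ω) z (basisVec y))

end

end Anderson

/-! This is the fractional moment method. As a function of the single variable `ω_x`, `G(x,y)` has
the form `A/(ω_x - β)` (rank one perturbation, `greenOf_update`), and `|t - β|^{-s}` is locally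
integrable for `s < 1`. Since `ν` has bounded density and compact support, the measures `|t -
β|^{-s} ν(dt)` put at most half their mass on a short interval, uniformly in `β`. A factor `|t -
α|^s` therefore cannot lower their integral by more than a constant (`exists_decoupling`).

The equation `(λω_x - z) G(x,y) = δ_{xy} + ∑ G(x+k,y)`, raised to the power `s` (subadditive for `s
< 1`), averaged and decoupled in `ω_x`, gives `c λ^s f(x) ≤ δ_{xy} + ∑ f(x+k)` for `f(x) =
E|G(x,y)|^s` (`lintegral_greenOf_subharmonic`). If `c λ^s ≥ 2(N+1)`, with `N` the number of
neighbours, each step away from `y` halves the bound on `f` (`le_pow_of_subharmonic`). The trivial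
bound `|Im z|^{-s}` serves only to make `sup f` finite, so the result is uniform in `z`.

The potential is almost surely bounded by `λR`, so it is truncated, and the operator theory is
needed for bounded potentials only. -/

namespace Anderson

/-! ### Resolvent and Green function for bounded potentials. -/

section Operator

variable {d : ℕ}

/-- Translation by `k` on `ℓ²(ℤ^d)`. -/
def shiftMap (k : Fin d → ℤ) : Ell2 d →ₗ[ℂ] Ell2 d where
  toFun u := ⟨fun n => u (n + k), memℓp_shift u k⟩
  map_add' u v := by ext n; rfl
  map_smul' c u := by ext n; rfl

theorem inner_shiftMap_left (k : Fin d → ℤ) (u w : Ell2 d) :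
    inner ℂ (shiftMap k u) w = inner ℂ u (shiftMap (-k) w) := by
  rw [lp.inner_eq_tsum, lp.inner_eq_tsum,
    ← (Equiv.addRight k).tsum_eq fun n => inner ℂ (u n) (shiftMap (-k) w n)]
  refine tsum_congr fun n => ?_
  change inner ℂ (u (n + k)) (w n) = inner ℂ (u (n + k)) (w (n + k + -k))
  rw [add_neg_cancel_right]

theorem neg_mem_unitVectors {k : Fin d → ℤ} (hk : k ∈ unitVectors d) : -k ∈ unitVectors d := by
  rw [mem_unitVectors] at hk ⊢
  simpa [latticeNorm] using hk

theorem laplacian_eq_neg_sum_shiftMap (u : Ell2 d) :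
    laplacian d u = -∑ k ∈ unitVectors d, shiftMap k u := by
  ext n
  rw [lp.coeFn_neg, lp.coeFn_sum, Pi.neg_apply, Finset.sum_apply]
  rfl

theorem isSymmetric_laplacian : (laplacian d).IsSymmetric := by
  intro u w
  rw [laplacian_eq_neg_sum_shiftMap, laplacian_eq_neg_sum_shiftMap, inner_neg_left,
    inner_neg_right, sum_inner, inner_sum]
  congr 1
  refine Finset.sum_nbij' (fun k => -k) (fun k => -k) (fun k => neg_mem_unitVectors)
    (fun k => neg_mem_unitVectors) (by simp) (by simp) fun k _ => inner_shiftMap_left k u w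

/-- Multiplication by a bounded real potential. -/
def mulMap (V : (Fin d → ℤ) → ℝ) {R : ℝ} (hV : ∀ n, |V n| ≤ R) : Ell2 d →ₗ[ℂ] Ell2 d where
  toFun u := ⟨fun n => (V n : ℂ) * u n, ((lp.memℓp u).const_mul (R : ℂ)).mono' fun n => by
    rw [norm_mul, norm_mul, Complex.norm_real, Complex.norm_real]
    exact mul_le_mul_of_nonneg_right ((hV n).trans (le_abs_self R)) (norm_nonneg _)⟩
  map_add' u v := by ext n; exact mul_add _ _ _
  map_smul' c u := by ext n; exact mul_left_comm _ _ _

theorem isSymmetric_mulMap (V : (Fin d → ℤ) → ℝ) {R : ℝ} (hV : ∀ n, |V n| ≤ R) :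
    (mulMap V hV).IsSymmetric := by
  intro u w
  rw [lp.inner_eq_tsum, lp.inner_eq_tsum]
  refine tsum_congr fun n => ?_
  change inner ℂ ((V n : ℂ) * u n) (w n) = inner ℂ (u n) ((V n : ℂ) * w n)
  simp only [RCLike.inner_apply, map_mul, Complex.conj_ofReal]
  ring

/-- `u` solves `(h₀ + V - z) u = f` pointwise. -/
def IsSolution (V : (Fin d → ℤ) → ℝ) (z : ℂ) (u f : Ell2 d) : Prop :=
  ∀ n, -∑ k ∈ unitVectors d, u (n + k) + (V n : ℂ) * u n - z * u n = f n

variable {V : (Fin d → ℤ) → ℝ} {R : ℝ} {z : ℂ} {u f : Ell2 d}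

theorem isSolution_iff (hV : ∀ n, |V n| ≤ R) :
    IsSolution V z u f ↔ (laplacian d + mulMap V hV) u - z • u = f := by
  rw [lp.ext_iff, funext_iff]
  rfl

/-- By symmetry `⟨u, (h₀ + V)u⟩` is real, so only the term with `z` contributes. This yields both
the a priori bound on `u` and the non-vanishing of `Im G(x,x)`. -/
theorem IsSolution.im_inner (h : IsSolution V z u f) (hV : ∀ n, |V n| ≤ R) :
    (inner ℂ u f).im = -(z.im * ‖u‖ ^ 2) := by
  have hT := isSymmetric_laplacian.add (isSymmetric_mulMap V hV)
  rw [← (isSolution_iff hV).1 h, inner_sub_right, inner_smul_right, inner_self_eq_norm_sq_to_K,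
    Complex.sub_im]
  have h0 := hT.im_inner_self_apply u
  have h1 : (inner ℂ u ((laplacian d + mulMap V hV) u)).im = 0 := h0
  rw [h1]
  have h2 : ((‖u‖ : ℂ) ^ 2) = ((‖u‖ ^ 2 : ℝ) : ℂ) := by push_cast; rfl
  change 0 - (z * (‖u‖ : ℂ) ^ 2).im = _
  rw [h2, Complex.im_mul_ofReal, zero_sub]

theorem IsSolution.norm_le (h : IsSolution V z u f) (hV : ∀ n, |V n| ≤ R) :
    |z.im| * ‖u‖ ≤ ‖f‖ := by
  have h1 : |z.im| * ‖u‖ ^ 2 ≤ ‖u‖ * ‖f‖ := by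
    have := (Complex.abs_im_le_norm _).trans (norm_inner_le_norm (𝕜 := ℂ) u f)
    rwa [h.im_inner hV, abs_neg, abs_mul, abs_of_nonneg (sq_nonneg ‖u‖)] at this
  rcases (norm_nonneg u).eq_or_lt with h0 | h0
  · rw [← h0]; simp
  · nlinarith

theorem IsSolution.sub {u' f' : Ell2 d} (h : IsSolution V z u f) (h' : IsSolution V z u' f') :
    IsSolution V z (u - u') (f - f') := by
  intro n
  have h1 := h n
  have h2 := h' n
  simp only [lp.coeFn_sub, Pi.sub_apply, Finset.sum_sub_distrib]
  linear_combination h1 - h2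

theorem IsSolution.unique {u' : Ell2 d} (h : IsSolution V z u f) (h' : IsSolution V z u' f)
    (hV : ∀ n, |V n| ≤ R) (hz : z.im ≠ 0) : u = u' := by
  have := (h.sub h').norm_le hV
  rw [sub_self, norm_zero] at this
  have h0 : 0 < |z.im| := abs_pos.2 hz
  rw [← sub_eq_zero, ← norm_eq_zero]
  nlinarith [norm_nonneg (u - u')]

/-- An everywhere defined symmetric map is bounded and self-adjoint (Hellinger–Toeplitz), so its
spectrum is real and misses `z`. -/
theorem exists_isSolution (hV : ∀ n, |V n| ≤ R) (hz : z.im ≠ 0) (f : Ell2 d) :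
    ∃ u, IsSolution V z u f := by
  have hT := isSymmetric_laplacian.add (isSymmetric_mulMap V hV)
  set A : Ell2 d →L[ℂ] Ell2 d := (hT.toSelfAdjoint : Ell2 d →L[ℂ] Ell2 d) with hA
  have hAs : IsSelfAdjoint A := hT.toSelfAdjoint.2
  have hspec : z ∉ spectrum ℂ A := fun hmem => hz (by
    rw [hAs.mem_spectrum_eq_re hmem]; simp)
  rw [spectrum.notMem_iff] at hspec
  obtain ⟨U, hU⟩ := hspec
  refine ⟨-((↑U⁻¹ : Ell2 d →L[ℂ] Ell2 d) f), (isSolution_iff hV).2 ?_⟩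
  have h1 : (algebraMap ℂ (Ell2 d →L[ℂ] Ell2 d) z - A) ((↑U⁻¹ : Ell2 d →L[ℂ] Ell2 d) f) = f := by
    rw [← hU, ← mul_apply_eq_comp, Units.mul_inv, one_apply_eq_self]
  have h2 : ∀ w, A w = (laplacian d + mulMap V hV) w := fun w => hT.toSelfAdjoint_apply
  rw [sub_apply, h2, Algebra.algebraMap_eq_smul_one,
    smul_apply, one_apply_eq_self] at h1
  rw [map_neg, smul_neg, neg_sub_neg]
  exact h1

theorem isSolution_resolventApply (hV : ∀ n, |V n| ≤ R) (hz : z.im ≠ 0) (f : Ell2 d) :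
    IsSolution V z (resolventApply (schrodinger V) z f) f := by
  obtain ⟨u, hu⟩ := exists_isSolution hV hz f
  have hex : ∃ w : (schrodinger V).domain, schrodinger V w - z • (w : Ell2 d) = f :=
    ⟨⟨u, (mulMap V hV u).2⟩, (isSolution_iff hV).1 hu⟩
  rw [resolventApply, dif_pos hex]
  intro n
  have := hex.choose_spec
  rw [lp.ext_iff, funext_iff] at this
  exact this n

/-- The Green function of `h₀ + V` at real potential `V`. -/
noncomputable def greenOf (V : (Fin d → ℤ) → ℝ) (x y : Fin d → ℤ) (z : ℂ) : ℂ :=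
  (resolventApply (schrodinger V) z (basisVec y)) x

theorem green_eq_greenOf (lam : ℝ) (ω : (Fin d → ℤ) → ℝ) (x y : Fin d → ℤ) :
    green lam ω x y z = greenOf (fun n => lam * ω n) x y z := by
  rw [green, basisVec, lp.inner_single_left]
  simp [greenOf, hamiltonian]

theorem norm_greenOf_le (hV : ∀ n, |V n| ≤ R) (hz : z.im ≠ 0) (x y : Fin d → ℤ) :
    ‖greenOf V x y z‖ ≤ |z.im|⁻¹ := by
  have h1 := (isSolution_resolventApply hV hz (basisVec y)).norm_le hV
  have h2 : ‖basisVec y‖ = 1 := by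
    rw [basisVec, lp.norm_single (by norm_num), norm_one]
  have h3 := lp.norm_apply_le_norm (p := 2) (by norm_num)
    (resolventApply (schrodinger V) z (basisVec y)) x
  have h0 : 0 < |z.im| := abs_pos.2 hz
  rw [h2] at h1
  refine h3.trans ?_
  rw [← one_div, le_div_iff₀ h0, mul_comm]
  exact h1

theorem greenOf_equation (hV : ∀ n, |V n| ≤ R) (hz : z.im ≠ 0) (x y : Fin d → ℤ) :
    ((V x : ℂ) - z) * greenOf V x y z =
      (if x = y then 1 else 0) + ∑ k ∈ unitVectors d, greenOf V (x + k) y z := by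
  have h := isSolution_resolventApply hV hz (basisVec y) x
  rw [basisVec, lp.single_apply, Pi.single_apply] at h
  change -∑ k ∈ unitVectors d, greenOf V (x + k) y z + (V x : ℂ) * greenOf V x y z
    - z * greenOf V x y z = _ at h
  rw [← h]
  ring

/-- Rank one perturbation formula. -/
theorem greenOf_update (hV : ∀ n, |V n| ≤ R) (hz : z.im ≠ 0) (x y : Fin d → ℤ) (t : ℝ) :
    greenOf (Function.update V x t) x y z * (1 + ((t - V x : ℝ) : ℂ) * greenOf V x x z) =
      greenOf V x y z := by
  have hV' : ∀ n, |Function.update V x t n| ≤ max R |t| := by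
    intro n
    rcases eq_or_ne n x with rfl | hn
    · simp
    · simpa [hn] using Or.inl (hV n)
  have hg := isSolution_resolventApply hV' hz (basisVec y)
  have hu := isSolution_resolventApply hV hz (basisVec y)
  have hw := isSolution_resolventApply hV hz (basisVec x)
  set g := resolventApply (schrodinger (Function.update V x t)) z (basisVec y) with hgdef
  set u := resolventApply (schrodinger V) z (basisVec y) with hudef
  set w := resolventApply (schrodinger V) z (basisVec x) with hwdef
  -- Moving the rank one change of potential to the source side shows that this combination solves
  -- the unperturbed equation. By uniqueness it is `u`; evaluation at `x` gives the formula.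
  have key : IsSolution V z (g + (((t - V x : ℝ) : ℂ) * g x) • w) (basisVec y) := by
    intro n
    have h1 := hg n
    have h2 := hw n
    simp only [lp.coeFn_add, lp.coeFn_smul, Pi.add_apply, Pi.smul_apply, smul_eq_mul,
      Finset.sum_add_distrib, ← Finset.mul_sum]
    rw [basisVec, lp.single_apply] at h2
    rcases eq_or_ne n x with rfl | hn
    · rw [Function.update_self] at h1
      rw [Pi.single_eq_same] at h2
      push_cast
      linear_combination h1 + (t - V n) * g n * h2
    · rw [Function.update_of_ne hn] at h1
      rw [Pi.single_eq_of_ne hn] at h2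
      push_cast
      linear_combination h1 + (t - V x) * g x * h2
  have := congrArg (fun v : Ell2 d => v x) (key.unique hu hV hz)
  simp only [lp.coeFn_add, lp.coeFn_smul, Pi.add_apply, Pi.smul_apply, smul_eq_mul] at this
  change g x * (1 + ((t - V x : ℝ) : ℂ) * w x) = u x
  rw [← this]
  ring

theorem greenOf_self_im_ne_zero (hV : ∀ n, |V n| ≤ R) (hz : z.im ≠ 0) (x : Fin d → ℤ) :
    (greenOf V x x z).im ≠ 0 := by
  have hw := isSolution_resolventApply hV hz (basisVec x)
  have h1 := hw.im_inner hV
  have hne : resolventApply (schrodinger V) z (basisVec x) ≠ 0 := by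
    intro h0
    have := hw x
    rw [h0, basisVec, lp.single_apply_self] at this
    simp at this
  set w := resolventApply (schrodinger V) z (basisVec x)
  have h2 : inner ℂ w (basisVec x) = (starRingEnd ℂ) (greenOf V x x z) := by
    rw [basisVec, lp.inner_single_right]
    simp [greenOf, w, basisVec]
  rw [h2, Complex.conj_im, neg_inj] at h1
  rw [h1]
  exact mul_ne_zero hz (pow_ne_zero 2 (norm_ne_zero_iff.2 hne))

theorem norm_sq_eq_tsum (u : Ell2 d) : ‖u‖ ^ 2 = ∑' n, ‖u n‖ ^ 2 := by
  have := lp.norm_rpow_eq_tsum (p := 2) (by norm_num) u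
  simpa using this

theorem summable_norm_sq (u : Ell2 d) : Summable fun n => ‖u n‖ ^ 2 := by
  have := (lp.memℓp u).summable (p := 2) (by norm_num)
  simpa using this

/-- The Green function depends continuously on a uniformly bounded potential, in the product
topology. -/
theorem continuous_greenOf {X : Type*} [TopologicalSpace X] (W : X → (Fin d → ℤ) → ℝ)
    (hW : Continuous W) (hR : ∀ a n, |W a n| ≤ R) (hz : z.im ≠ 0) (x y : Fin d → ℤ) :
    Continuous fun a => greenOf (W a) x y z := by
  rw [continuous_iff_continuousAt]
  intro a₀
  set u := resolventApply (schrodinger (W a₀)) z (basisVec y) with hu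
  have hR' : ∀ a n, |W a₀ n - W a n| ≤ R + R := fun a n =>
    (abs_sub _ _).trans (add_le_add (hR a₀ n) (hR a n))
  have hR0 : ∀ n, 0 ≤ R := fun n => (abs_nonneg _).trans (hR a₀ n)
  -- Second resolvent identity, with the source built from the fixed vector `u` at `a₀`. The a
  -- priori bound is uniform in `a`, so pointwise convergence of the potentials, dominated by a
  -- multiple of `‖u n‖ ^ 2`, suffices.
  have hsol : ∀ a, IsSolution (W a) z (resolventApply (schrodinger (W a)) z (basisVec y) - u)
      (mulMap (fun n => W a₀ n - W a n) (hR' a) u) := by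
    intro a n
    have h1 := isSolution_resolventApply (hR a) hz (basisVec y) n
    have h2 := isSolution_resolventApply (hR a₀) hz (basisVec y) n
    rw [← hu] at h2
    simp only [lp.coeFn_sub, Pi.sub_apply, Finset.sum_sub_distrib]
    change _ = ((W a₀ n - W a n : ℝ) : ℂ) * u n
    push_cast
    linear_combination h1 - h2
  have hlim : Filter.Tendsto (fun a => ‖mulMap (fun n => W a₀ n - W a n) (hR' a) u‖ ^ 2)
      (nhds a₀) (nhds 0) := by
    have h0 : (0 : ℝ) = ∑' n : Fin d → ℤ, (0 : ℝ) := by simp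
    rw [h0]
    simp only [norm_sq_eq_tsum]
    refine tendsto_tsum_of_dominated_convergence
      (bound := fun n => (R + R) ^ 2 * ‖u n‖ ^ 2) ((summable_norm_sq u).mul_left _) ?_ ?_
    · intro n
      change Filter.Tendsto (fun a => ‖((W a₀ n - W a n : ℝ) : ℂ) * u n‖ ^ 2) _ _
      have hc : Continuous fun a => ‖((W a₀ n - W a n : ℝ) : ℂ) * u n‖ ^ 2 := by
        have := (continuous_apply n).comp hW
        simp only [Function.comp_def] at this
        fun_prop
      simpa using hc.tendsto a₀
    · refine Filter.Eventually.of_forall fun a n => ?_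
      change ‖‖((W a₀ n - W a n : ℝ) : ℂ) * u n‖ ^ 2‖ ≤ _
      rw [norm_pow, norm_norm, norm_mul, mul_pow, Complex.norm_real, Real.norm_eq_abs]
      gcongr
      exact hR' a n
  have hlim' : Filter.Tendsto (fun a => ‖mulMap (fun n => W a₀ n - W a n) (hR' a) u‖)
      (nhds a₀) (nhds 0) := by
    have := hlim.sqrt
    simpa [Real.sqrt_sq] using this
  rw [ContinuousAt, tendsto_iff_norm_sub_tendsto_zero]
  have h0 : 0 < |z.im| := abs_pos.2 hz
  refine squeeze_zero (fun _ => norm_nonneg _) (fun a => ?_)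
    (by simpa using hlim'.const_mul |z.im|⁻¹)
  have h1 := (hsol a).norm_le (hR a)
  have h2 := lp.norm_apply_le_norm (p := 2) (by norm_num)
    (resolventApply (schrodinger (W a)) z (basisVec y) - u) x
  rw [inv_mul_eq_div, le_div_iff₀ h0, mul_comm]
  exact (mul_le_mul_of_nonneg_left h2 h0.le).trans h1

end Operator

/-! ### Decoupling inequality for the single-site measure. -/

section Decoupling

theorem setLIntegral_Ioo_enorm_rpow_neg_ne_top {s : ℝ} (hs1 : s < 1) :
    ∫⁻ t in Set.Ioo (-1 : ℝ) 1, ‖t‖ₑ ^ (-s) ≠ ∞ := by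
  have h1 : ∫⁻ t in Set.Ioo (0 : ℝ) 1, ‖t‖ₑ ^ (-s) < ∞ := by
    have h : IntegrableOn (fun t : ℝ => t ^ (-s)) (Set.Ioo 0 1) :=
      (intervalIntegral.integrableOn_Ioo_rpow_iff one_pos).2 (by linarith)
    refine lt_of_eq_of_lt (setLIntegral_congr_fun measurableSet_Ioo fun t ht => ?_) h.2
    change ‖t‖ₑ ^ (-s) = ‖t ^ (-s)‖ₑ
    rw [Real.enorm_of_nonneg ht.1.le, Real.enorm_of_nonneg (Real.rpow_nonneg ht.1.le _),
      ENNReal.ofReal_rpow_of_pos ht.1]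
  have h2 : ∫⁻ t in Set.Ioo (-1 : ℝ) 0, ‖t‖ₑ ^ (-s) < ∞ := by
    refine lt_of_eq_of_lt ?_ h1
    have := (Measure.measurePreserving_neg (volume : Measure ℝ)).setLIntegral_comp_preimage_emb
      (Homeomorph.neg ℝ).measurableEmbedding (fun t => ‖t‖ₑ ^ (-s)) (Set.Ioo 0 1)
    rw [← this]
    simp
  have hsub : Set.Ioo (-1 : ℝ) 1 ⊆ (Set.Ioo (-1 : ℝ) 0 ∪ Set.Ioo (0 : ℝ) 1) ∪ {0} := by
    intro t ht
    rcases lt_trichotomy t 0 with h | h | h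
    · exact Or.inl (Or.inl ⟨ht.1, h⟩)
    · exact Or.inr h
    · exact Or.inl (Or.inr ⟨h, ht.2⟩)
  refine ne_top_of_le_ne_top ?_ (lintegral_mono_set hsub)
  refine ne_top_of_le_ne_top ?_ (lintegral_union_le _ _ _)
  refine ne_top_of_le_ne_top ?_ (add_le_add_left (lintegral_union_le _ _ _) _)
  simp [h1.ne, h2.ne]

/-- The singularity `|t - b|^{-s}`, `s < 1`, is integrable uniformly on short intervals. -/
theorem exists_setLIntegral_ball_lt {s : ℝ} (hs0 : 0 < s) (hs1 : s < 1) {ε : ℝ≥0∞} (hε : ε ≠ 0) :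
    ∃ δ₀ : ℝ, 0 < δ₀ ∧ ∀ δ : ℝ, δ ≤ δ₀ → ∀ a b : ℝ,
      ∫⁻ t in Metric.ball a δ, ‖t - b‖ₑ ^ (-s) ≤ ε + ENNReal.ofReal (2 * δ) := by
  set f : ℝ → ℝ≥0∞ := (Set.Ioo (-1 : ℝ) 1).indicator fun t => ‖t‖ₑ ^ (-s) with hf
  have hfin : ∫⁻ t, f t ≠ ∞ := by
    rw [hf, lintegral_indicator measurableSet_Ioo]
    exact setLIntegral_Ioo_enorm_rpow_neg_ne_top hs1
  -- Absolute continuity of the integral gives a threshold depending only on the length of the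
  -- interval; once `b` is translated to `0` it serves all `a` and `b`.
  obtain ⟨η, hη0, hη⟩ := exists_pos_setLIntegral_lt_of_measure_lt hfin hε
  obtain ⟨δ₀, hδ0, hδ⟩ : ∃ δ₀ : ℝ, 0 < δ₀ ∧ ENNReal.ofReal (2 * δ₀) < η := by
    obtain ⟨r, hr0, hr⟩ := ENNReal.lt_iff_exists_nnreal_btwn.1 hη0
    refine ⟨r / 2, by have : (0:ℝ) < r := by exact_mod_cast hr0
                      positivity, ?_⟩
    rw [mul_div_cancel₀ _ two_ne_zero, ENNReal.ofReal_coe_nnreal]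
    exact hr
  refine ⟨δ₀, hδ0, fun δ hle a b => ?_⟩
  have hle1 : ∀ t : ℝ, ‖t‖ₑ ^ (-s) ≤ f t + 1 := by
    intro t
    by_cases ht : t ∈ Set.Ioo (-1 : ℝ) 1
    · rw [hf, Set.indicator_of_mem ht]
      exact le_self_add
    · refine le_add_left ?_
      have h1 : 1 ≤ |t| := by
        by_contra hlt
        exact ht (abs_lt.1 (not_le.1 hlt))
      rw [ENNReal.rpow_neg, ENNReal.inv_le_one]
      refine ENNReal.one_le_rpow ?_ hs0
      rw [Real.enorm_eq_ofReal_abs]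
      exact ENNReal.one_le_ofReal.2 h1
  have htrans : ∫⁻ t in Metric.ball a δ, ‖t - b‖ₑ ^ (-s) =
      ∫⁻ t in Metric.ball (a - b) δ, ‖t‖ₑ ^ (-s) := by
    have := (measurePreserving_sub_right volume b).setLIntegral_comp_preimage_emb
      (Homeomorph.subRight b).measurableEmbedding (fun t => ‖t‖ₑ ^ (-s)) (Metric.ball (a - b) δ)
    rw [← this]
    congr 2
    ext t
    simp [dist_eq_norm]
  rw [htrans]
  calc ∫⁻ t in Metric.ball (a - b) δ, ‖t‖ₑ ^ (-s)
      ≤ ∫⁻ t in Metric.ball (a - b) δ, (f t + 1) := lintegral_mono hle1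
    _ = (∫⁻ t in Metric.ball (a - b) δ, f t) + ENNReal.ofReal (2 * δ) := by
      rw [lintegral_add_right _ measurable_const, setLIntegral_const, one_mul, Real.volume_ball]
    _ ≤ ε + ENNReal.ofReal (2 * δ) := by
      gcongr
      refine (hη _ ?_).le
      rw [Real.volume_ball]
      refine lt_of_le_of_lt ?_ hδ
      gcongr

variable {ν : Measure ℝ} {K : ℝ≥0∞} {R s : ℝ}

/-- For compactly supported `ν` with bounded density, the measures `|t - β|^{-s} ν(dt)` do not
concentrate on short intervals. -/
theorem exists_not_concentrated [IsProbabilityMeasure ν] (hK : K ≠ ∞) (hνK : ν ≤ K • volume) (hR : 0 < R)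
    (hνR : ∀ᵐ t ∂ν, |t| ≤ R) (hs0 : 0 < s) (hs1 : s < 1) :
    ∃ δ : ℝ, 0 < δ ∧ ∀ (α : ℝ) (β : ℂ), ∃ e : ℝ≥0∞, e ≠ ∞ ∧
      ∫⁻ t in Metric.ball α δ, ‖(t : ℂ) - β‖ₑ ^ (-s) ∂ν ≤ e ∧
      2 * e ≤ ∫⁻ t, ‖(t : ℂ) - β‖ₑ ^ (-s) ∂ν := by
  set Q : ℝ≥0∞ := ENNReal.ofReal (2 * R) ^ s with hQ
  have hQtop : Q ≠ ∞ := ENNReal.rpow_ne_top_of_nonneg hs0.le ENNReal.ofReal_ne_top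
  -- the mass of a ball of radius `δ` is at most `M * (ε + ofReal (2 * δ))`
  set M : ℝ≥0∞ := K + Q * K with hM
  have hMtop : M ≠ ∞ := ENNReal.add_ne_top.2 ⟨hK, ENNReal.mul_ne_top hQtop hK⟩
  obtain ⟨ε, hε0, hε⟩ : ∃ ε : ℝ, 0 < ε ∧ M * ENNReal.ofReal (2 * ε) ≤ 2⁻¹ := by
    refine ⟨(M.toReal + 1)⁻¹ / 4, by positivity, ?_⟩
    rw [← ENNReal.ofReal_toReal hMtop, ← ENNReal.ofReal_mul ENNReal.toReal_nonneg,
      show (2⁻¹ : ℝ≥0∞) = ENNReal.ofReal 2⁻¹ by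
        rw [ENNReal.ofReal_inv_of_pos two_pos, ENNReal.ofReal_ofNat]]
    refine ENNReal.ofReal_le_ofReal ?_
    rw [ENNReal.toReal_ofReal ENNReal.toReal_nonneg]
    have h0 : 0 ≤ M.toReal := ENNReal.toReal_nonneg
    have h1 : M.toReal * (M.toReal + 1)⁻¹ ≤ 1 := by
      rw [← div_eq_mul_inv, div_le_one (by positivity)]; linarith
    linarith
  obtain ⟨δ₀, hδ0, hδ⟩ := exists_setLIntegral_ball_lt hs0 hs1
    (ε := ENNReal.ofReal ε) (by simpa using hε0)
  set δ := min δ₀ (ε / 2) with hδdef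
  have hδpos : 0 < δ := lt_min hδ0 (by positivity)
  have h2δ : 2 * δ ≤ ε := by
    have := min_le_right δ₀ (ε / 2)
    linarith
  refine ⟨δ, hδpos, fun α β => ?_⟩
  -- `D` is the scale that makes the estimate uniform as `|β| → ∞`. On the support `|t - β| ≤ D`, so
  -- the total integral is at least `D^{-s}`; conversely `D ≤ |t - β| + 2R` bounds the integral over
  -- a short ball by `D^{-s}/2`, which is the witness `e`.
  set D : ℝ≥0∞ := ‖β‖ₑ + ENNReal.ofReal R with hD
  have hD0 : D ≠ 0 := by
    have : ENNReal.ofReal R ≠ 0 := by simpa using hR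
    simp [hD, this]
  have hDtop : D ≠ ∞ := by simp [hD]
  have hDs0 : D ^ s ≠ 0 := by simp [ENNReal.rpow_eq_zero_iff, hD0, hDtop]
  have hDstop : D ^ s ≠ ∞ := ENNReal.rpow_ne_top_of_nonneg hs0.le hDtop
  have htR : ∀ t : ℝ, |t| ≤ R → ‖(t : ℂ)‖ₑ ≤ ENNReal.ofReal R := fun t ht => by
    rw [← ofReal_norm, Complex.norm_real]
    exact ENNReal.ofReal_le_ofReal ht
  refine ⟨(D ^ s)⁻¹ * 2⁻¹, ENNReal.mul_ne_top (ENNReal.inv_ne_top.2 hDs0) (by simp), ?_, ?_⟩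
  · have hpt : ∀ᵐ t : ℝ ∂ν, ‖(t : ℂ) - β‖ₑ ^ (-s) ≤ (D ^ s)⁻¹ * (1 + Q * ‖t - β.re‖ₑ ^ (-s)) := by
      filter_upwards [hνR] with t ht
      have hw : ‖(t : ℂ) - β‖ₑ ^ (-s) ≤ ‖t - β.re‖ₑ ^ (-s) := by
        rw [ENNReal.rpow_neg, ENNReal.rpow_neg, ENNReal.inv_le_inv]
        refine ENNReal.rpow_le_rpow ?_ hs0.le
        rw [← ofReal_norm, ← ofReal_norm]
        refine ENNReal.ofReal_le_ofReal ?_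
        have := Complex.abs_re_le_norm ((t : ℂ) - β)
        simpa using this
      have hDle : D ≤ ‖(t : ℂ) - β‖ₑ + ENNReal.ofReal (2 * R) := by
        have h1 : ‖β‖ₑ ≤ ‖(t : ℂ)‖ₑ + ‖(t : ℂ) - β‖ₑ := by
          have := enorm_sub_le (a := (t : ℂ)) (b := (t : ℂ) - β)
          rwa [sub_sub_cancel] at this
        rw [two_mul, ENNReal.ofReal_add hR.le hR.le, hD]
        calc ‖β‖ₑ + ENNReal.ofReal R ≤ (‖(t : ℂ)‖ₑ + ‖(t : ℂ) - β‖ₑ) + ENNReal.ofReal R := by gcongr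
          _ ≤ (ENNReal.ofReal R + ‖(t : ℂ) - β‖ₑ) + ENNReal.ofReal R := by gcongr; exact htR t ht
          _ = _ := by ring
      have hDs : D ^ s ≤ ‖(t : ℂ) - β‖ₑ ^ s + Q :=
        (ENNReal.rpow_le_rpow hDle hs0.le).trans (ENNReal.rpow_add_le_add_rpow _ _ hs0.le hs1.le)
      calc ‖(t : ℂ) - β‖ₑ ^ (-s) = (D ^ s)⁻¹ * (D ^ s * ‖(t : ℂ) - β‖ₑ ^ (-s)) := by
            rw [← mul_assoc, ENNReal.inv_mul_cancel hDs0 hDstop, one_mul]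
        _ ≤ (D ^ s)⁻¹ * ((‖(t : ℂ) - β‖ₑ ^ s + Q) * ‖(t : ℂ) - β‖ₑ ^ (-s)) := by gcongr
        _ ≤ (D ^ s)⁻¹ * (1 + Q * ‖t - β.re‖ₑ ^ (-s)) := by
            rw [add_mul]
            gcongr
            rw [ENNReal.rpow_neg]
            exact ENNReal.mul_inv_le_one _
    have hmeas : Measurable fun t : ℝ => ‖t - β.re‖ₑ ^ (-s) := by fun_prop
    calc ∫⁻ t in Metric.ball α δ, ‖(t : ℂ) - β‖ₑ ^ (-s) ∂ν
        ≤ ∫⁻ t in Metric.ball α δ, (D ^ s)⁻¹ * (1 + Q * ‖t - β.re‖ₑ ^ (-s)) ∂ν :=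
          lintegral_mono_ae (ae_restrict_of_ae hpt)
      _ ≤ ∫⁻ t in Metric.ball α δ, (D ^ s)⁻¹ * (1 + Q * ‖t - β.re‖ₑ ^ (-s)) ∂(K • volume) :=
          lintegral_mono' (Measure.restrict_mono le_rfl hνK) le_rfl
      _ = (D ^ s)⁻¹ * (K * (ENNReal.ofReal (2 * δ) +
            Q * ∫⁻ t in Metric.ball α δ, ‖t - β.re‖ₑ ^ (-s))) := by
          rw [Measure.restrict_smul, lintegral_smul_measure, lintegral_const_mul _ (by fun_prop),
            lintegral_add_left measurable_const, setLIntegral_const, one_mul, Real.volume_ball,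
            lintegral_const_mul _ hmeas, smul_eq_mul]
          ring
      _ ≤ (D ^ s)⁻¹ * (K * (ENNReal.ofReal (2 * ε) + Q * ENNReal.ofReal (2 * ε))) := by
          have h1 : ENNReal.ofReal (2 * δ) ≤ ENNReal.ofReal (2 * ε) :=
            ENNReal.ofReal_le_ofReal (by linarith)
          have h2 : ∫⁻ t in Metric.ball α δ, ‖t - β.re‖ₑ ^ (-s) ≤ ENNReal.ofReal (2 * ε) := by
            refine (hδ δ (min_le_left _ _) α β.re).trans ?_
            rw [← ENNReal.ofReal_add hε0.le (by positivity)]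
            exact ENNReal.ofReal_le_ofReal (by linarith)
          gcongr
      _ = (D ^ s)⁻¹ * (M * ENNReal.ofReal (2 * ε)) := by rw [hM]; ring
      _ ≤ (D ^ s)⁻¹ * 2⁻¹ := by gcongr
  · have h2 : 2 * ((D ^ s)⁻¹ * 2⁻¹) = (D ^ s)⁻¹ := by
      rw [mul_left_comm, ENNReal.mul_inv_cancel two_ne_zero (by simp), mul_one]
    rw [h2]
    calc (D ^ s)⁻¹ = ∫⁻ _, (D ^ s)⁻¹ ∂ν := by simp
      _ ≤ _ := by
        refine lintegral_mono_ae ?_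
        filter_upwards [hνR] with t ht
        rw [ENNReal.rpow_neg, ENNReal.inv_le_inv]
        refine ENNReal.rpow_le_rpow ?_ hs0.le
        refine enorm_sub_le.trans ?_
        rw [add_comm]
        exact add_le_add_right (htR t ht) _

/-- The decoupling inequality. -/
theorem exists_decoupling [IsProbabilityMeasure ν] (hK : K ≠ ∞) (hνK : ν ≤ K • volume) (hR : 0 < R)
    (hνR : ∀ᵐ t ∂ν, |t| ≤ R) (hs0 : 0 < s) (hs1 : s < 1) :
    ∃ c : ℝ, 0 < c ∧ ∀ (α : ℝ) (β : ℂ),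
      ENNReal.ofReal c * ∫⁻ t, ‖(t : ℂ) - β‖ₑ ^ (-s) ∂ν ≤
        ∫⁻ t, ‖t - α‖ₑ ^ s * ‖(t : ℂ) - β‖ₑ ^ (-s) ∂ν := by
  obtain ⟨δ, hδ, h⟩ := exists_not_concentrated hK hνK hR hνR hs0 hs1
  -- At least half of the integral lives off the ball, where `|t - α|^s ≥ δ^s`. Finiteness of `e`
  -- allows cancellation without knowing that the whole integral is finite.
  refine ⟨δ ^ s * 2⁻¹, by positivity, fun α β => ?_⟩
  obtain ⟨e, he, h1, h2⟩ := h α β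
  set B := Metric.ball α δ
  set J := ∫⁻ t in Bᶜ, ‖(t : ℂ) - β‖ₑ ^ (-s) ∂ν with hJ
  have hsplit := lintegral_add_compl (μ := ν) (fun t : ℝ => ‖(t : ℂ) - β‖ₑ ^ (-s))
    (measurableSet_ball (x := α) (ε := δ))
  set W := ∫⁻ t, ‖(t : ℂ) - β‖ₑ ^ (-s) ∂ν with hW
  have hWle : W ≤ e + J := by rw [← hsplit]; exact add_le_add_left h1 _
  have heJ : e ≤ J := by
    have : e + e ≤ e + J := by rw [← two_mul]; exact h2.trans hWle
    exact (ENNReal.add_le_add_iff_left he).1 this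
  have hWJ : W ≤ 2 * J := hWle.trans (by rw [two_mul]; exact add_le_add_left heJ _)
  have hδs : ENNReal.ofReal (δ ^ s) = ENNReal.ofReal δ ^ s :=
    (ENNReal.ofReal_rpow_of_pos hδ).symm
  calc ENNReal.ofReal (δ ^ s * 2⁻¹) * W
      ≤ ENNReal.ofReal (δ ^ s * 2⁻¹) * (2 * J) := by gcongr
    _ = ENNReal.ofReal δ ^ s * J := by
      rw [ENNReal.ofReal_mul (by positivity), ENNReal.ofReal_inv_of_pos two_pos,
        ENNReal.ofReal_ofNat, hδs, mul_assoc, ← mul_assoc 2⁻¹,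
        ENNReal.inv_mul_cancel two_ne_zero (by simp), one_mul]
    _ = ∫⁻ t in Bᶜ, ENNReal.ofReal δ ^ s * ‖(t : ℂ) - β‖ₑ ^ (-s) ∂ν := by
      rw [lintegral_const_mul]
      fun_prop
    _ ≤ ∫⁻ t in Bᶜ, ‖t - α‖ₑ ^ s * ‖(t : ℂ) - β‖ₑ ^ (-s) ∂ν := by
      refine setLIntegral_mono' measurableSet_ball.compl fun t ht => ?_
      gcongr
      rw [Real.enorm_eq_ofReal_abs]
      refine ENNReal.ofReal_le_ofReal ?_
      simpa [B, Real.dist_eq] using ht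
    _ ≤ _ := setLIntegral_le_lintegral _ _

/-- Decoupling for a function of the form `u / (1 + (lam t - a) w)`. -/
theorem decoupling_fractional {c : ℝ}
    (hdec : ∀ (α : ℝ) (β : ℂ),
      ENNReal.ofReal c * ∫⁻ t, ‖(t : ℂ) - β‖ₑ ^ (-s) ∂ν ≤
        ∫⁻ t, ‖t - α‖ₑ ^ s * ‖(t : ℂ) - β‖ₑ ^ (-s) ∂ν)
    (hs0 : 0 < s) {lam : ℝ} (hlam : 0 < lam) {g : ℝ → ℂ} {u w z : ℂ} {a : ℝ} (hw : w.im ≠ 0)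
    (hg : ∀ᵐ t ∂ν, g t * (1 + ((lam * t - a : ℝ) : ℂ) * w) = u) :
    ENNReal.ofReal c * ENNReal.ofReal lam ^ s * ∫⁻ t, ‖g t‖ₑ ^ s ∂ν ≤
      ∫⁻ t, ‖((lam * t : ℝ) : ℂ) - z‖ₑ ^ s * ‖g t‖ₑ ^ s ∂ν := by
  have hw0 : w ≠ 0 := fun h => hw (by rw [h]; rfl)
  have hl0 : (lam : ℂ) ≠ 0 := by exact_mod_cast hlam.ne'
  -- `β` is the pole in `t` of `u / (1 + (lam t - a) w)`, and `A` the residue.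
  set β : ℂ := a / lam - 1 / (lam * w) with hβ
  set A : ℂ := u / (lam * w) with hA
  have hgt : ∀ᵐ t : ℝ ∂ν, ‖g t‖ₑ ^ s = ‖A‖ₑ ^ s * ‖(t : ℂ) - β‖ₑ ^ (-s) := by
    filter_upwards [hg] with t ht
    have hden : 1 + ((lam * t - a : ℝ) : ℂ) * w = lam * w * (t - β) := by
      rw [hβ]
      push_cast
      field_simp
      ring
    -- The imaginary part is `(lam t - a) Im w`; if it vanished, then `lam t = a` and the
    -- denominator would be `1`.
    have hne : 1 + ((lam * t - a : ℝ) : ℂ) * w ≠ 0 := by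
      intro h0
      have him := congrArg Complex.im h0
      rw [Complex.add_im, Complex.im_ofReal_mul, Complex.one_im, Complex.zero_im, zero_add,
        mul_eq_zero, or_iff_left hw] at him
      rw [him] at h0
      simp at h0
    rw [hden] at ht hne
    have htβ : (t : ℂ) - β ≠ 0 := right_ne_zero_of_mul hne
    have hgA : g t = A * ((t : ℂ) - β)⁻¹ := by
      rw [hA, ← ht]
      field_simp
    rw [hgA, enorm_mul, enorm_inv htβ, ENNReal.mul_rpow_of_nonneg _ _ hs0.le, ENNReal.inv_rpow,
      ENNReal.rpow_neg]
  -- Decoupling takes a real `α`; dropping `Im z` only decreases the factor, which leaves `α = Re z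
  -- / lam`.
  have hz : ∀ t : ℝ, ENNReal.ofReal lam ^ s * ‖t - z.re / lam‖ₑ ^ s ≤
      ‖((lam * t : ℝ) : ℂ) - z‖ₑ ^ s := by
    intro t
    rw [← ENNReal.mul_rpow_of_nonneg _ _ hs0.le]
    refine ENNReal.rpow_le_rpow ?_ hs0.le
    rw [← ofReal_norm, ← ofReal_norm, ← ENNReal.ofReal_mul hlam.le]
    refine ENNReal.ofReal_le_ofReal ?_
    have h1 := Complex.abs_re_le_norm (((lam * t : ℝ) : ℂ) - z)
    rw [Complex.sub_re, Complex.ofReal_re] at h1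
    refine le_trans (le_of_eq ?_) h1
    rw [Real.norm_eq_abs]
    nth_rewrite 1 [← abs_of_pos hlam]
    rw [← abs_mul, mul_sub, mul_div_cancel₀ _ hlam.ne']
  rw [lintegral_congr_ae hgt, lintegral_const_mul _ (by fun_prop)]
  calc ENNReal.ofReal c * ENNReal.ofReal lam ^ s *
        (‖A‖ₑ ^ s * ∫⁻ t, ‖(t : ℂ) - β‖ₑ ^ (-s) ∂ν)
      = (ENNReal.ofReal lam ^ s * ‖A‖ₑ ^ s) *
        (ENNReal.ofReal c * ∫⁻ t, ‖(t : ℂ) - β‖ₑ ^ (-s) ∂ν) := by ring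
    _ ≤ (ENNReal.ofReal lam ^ s * ‖A‖ₑ ^ s) *
        ∫⁻ t, ‖t - z.re / lam‖ₑ ^ s * ‖(t : ℂ) - β‖ₑ ^ (-s) ∂ν := by
      gcongr
      exact hdec _ _
    _ = ∫⁻ t, (ENNReal.ofReal lam ^ s * ‖A‖ₑ ^ s) *
        (‖t - z.re / lam‖ₑ ^ s * ‖(t : ℂ) - β‖ₑ ^ (-s)) ∂ν := by
      rw [lintegral_const_mul _ (by fun_prop)]
    _ ≤ _ := by
      refine lintegral_mono_ae ?_
      filter_upwards [hgt] with t ht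
      rw [ht]
      calc _ = (ENNReal.ofReal lam ^ s * ‖t - z.re / lam‖ₑ ^ s) *
            (‖A‖ₑ ^ s * ‖(t : ℂ) - β‖ₑ ^ (-s)) := by ring
        _ ≤ _ := by gcongr; exact hz t

end Decoupling

/-! ### Resampling, iteration on the lattice, truncation. -/

/-- Resampling one coordinate does not change the law of an i.i.d. family. -/
theorem map_update_infinitePi {ι : Type*} [DecidableEq ι] (ν : Measure ℝ)
    [IsProbabilityMeasure ν] (x : ι) :
    ((Measure.infinitePi fun _ : ι => ν).prod ν).map
      (fun p : (ι → ℝ) × ℝ => Function.update p.1 x p.2) = Measure.infinitePi fun _ : ι => ν := by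
  have hm : Measurable fun p : (ι → ℝ) × ℝ => Function.update p.1 x p.2 := by
    rw [measurable_pi_iff]
    intro n
    rcases eq_or_ne n x with rfl | hn
    · simpa using measurable_snd
    · simpa [hn, Function.comp_def] using
        (measurable_pi_apply (X := fun _ : ι => ℝ) n).comp measurable_fst
  refine Measure.eq_infinitePi _ fun I t ht => ?_
  rw [Measure.map_apply hm (MeasurableSet.pi I.countable_toSet fun i _ => ht i)]
  by_cases hx : x ∈ I
  · have : (fun p : (ι → ℝ) × ℝ => Function.update p.1 x p.2) ⁻¹' (Set.pi I t) =
        (Set.pi ↑(I.erase x) t) ×ˢ t x := by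
      ext ⟨v, r⟩
      simp only [Set.mem_preimage, Set.mem_pi, Set.mem_prod, Finset.mem_coe, Finset.mem_erase]
      constructor
      · intro h
        refine ⟨fun i hi => by simpa [hi.1] using h i hi.2, by simpa using h x hx⟩
      · rintro ⟨h1, h2⟩ i hi
        rcases eq_or_ne i x with rfl | hn
        · simpa using h2
        · simpa [hn] using h1 i ⟨hn, hi⟩
    rw [this, Measure.prod_prod, Measure.infinitePi_pi _ fun i _ => ht i,
      Finset.prod_erase_mul _ _ hx]
  · have : (fun p : (ι → ℝ) × ℝ => Function.update p.1 x p.2) ⁻¹' (Set.pi I t) =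
        (Set.pi ↑I t) ×ˢ Set.univ := by
      ext ⟨v, r⟩
      simp only [Set.mem_preimage, Set.mem_pi, Set.mem_prod, Finset.mem_coe, Set.mem_univ,
        and_true]
      refine forall₂_congr fun i hi => ?_
      have hn : i ≠ x := fun h => hx (h ▸ hi)
      simp [hn]
    rw [this, Measure.prod_prod, Measure.infinitePi_pi _ fun i _ => ht i, measure_univ, mul_one]

/-- Exponential decay for nonnegative bounded solutions of the subharmonicity inequality
`L f(x) ≤ δ_{xy} + ∑_{|k| = 1} f(x + k)` with large `L`. -/
theorem le_pow_of_subharmonic {d : ℕ} {f : (Fin d → ℤ) → ℝ≥0∞} {B : ℝ≥0∞} (hB : B ≠ ∞)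
    (hfB : ∀ x, f x ≤ B) (y : Fin d → ℤ)
    (hf : ∀ x, 2 * ((unitVectors d).card + 1 : ℝ≥0∞) * f x ≤
      (if x = y then 1 else 0) + ∑ k ∈ unitVectors d, f (x + k))
    (n : ℕ) (x : Fin d → ℤ) (hn : (n : ℤ) ≤ latticeNorm (x - y)) : f x ≤ 2⁻¹ ^ n := by
  set N : ℝ≥0∞ := ((unitVectors d).card : ℝ≥0∞) with hN
  have hN0 : N + 1 ≠ 0 := by simp
  have hNtop : N + 1 ≠ ∞ := by simp [hN]
  have hsum : ∀ (x : Fin d → ℤ) (b : ℝ≥0∞), (∀ k ∈ unitVectors d, f (x + k) ≤ b) →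
      ∑ k ∈ unitVectors d, f (x + k) ≤ N * b := fun x b h => by
    simpa [hN] using Finset.sum_le_card_nsmul _ _ b h
  have hdiv : ∀ a b : ℝ≥0∞, 2 * (N + 1) * a ≤ (N + 1) * b → 2 * a ≤ b := fun a b h => by
    rw [mul_comm (2 : ℝ≥0∞), mul_assoc] at h
    exact (ENNReal.mul_le_mul_iff_right hN0 hNtop).1 h
  induction n generalizing x with
  | zero =>
    set S := ⨆ x, f x with hS
    have hStop : S ≠ ∞ := ne_top_of_le_ne_top hB (iSup_le hfB)
    -- The slack `N + S` completes the product `(N + 1)(1 + S)`. Taking suprema gives `2S ≤ 1 + S`,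
    -- hence `S ≤ 1` because `S` is finite; the size of `B` drops out.
    have h1 : ∀ x, 2 * f x ≤ 1 + S := fun x => hdiv _ _ <| by
      refine (hf x).trans ((add_le_add_right (hsum x S fun k _ => le_iSup f _) _).trans ?_)
      calc (if x = y then 1 else 0) + N * S ≤ 1 + N * S := by gcongr; split_ifs <;> simp
        _ ≤ (1 + N * S) + (N + S) := le_self_add
        _ = (N + 1) * (1 + S) := by ring
    have h2 : S + S ≤ 1 + S := by
      rw [← two_mul, hS, ENNReal.mul_iSup]
      exact iSup_le h1
    rw [pow_zero]
    exact (le_iSup f x).trans ((ENNReal.add_le_add_iff_right hStop).1 h2)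
  | succ n ih =>
    have hxy : x ≠ y := by
      rintro rfl
      rw [sub_self] at hn
      simp only [latticeNorm, Pi.zero_apply, abs_zero, Finset.sum_const_zero] at hn
      omega
    -- All neighbours of `x` are at distance at least `n` from `y`, and the delta term is absent, so
    -- the inequality gains a factor of one half.
    have h1 : 2 * f x ≤ 2⁻¹ ^ n := hdiv _ _ <| by
      refine (hf x).trans ?_
      rw [if_neg hxy, zero_add]
      refine (hsum x (2⁻¹ ^ n) fun k hk => ih _ ?_).trans ?_
      · rw [mem_unitVectors] at hk
        have : latticeNorm (x - y) ≤ latticeNorm (x + k - y) + latticeNorm k := by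
          simp only [latticeNorm]
          rw [← Finset.sum_add_distrib]
          refine Finset.sum_le_sum fun i _ => ?_
          have h := abs_sub ((x + k - y) i) (k i)
          have e : (x + k - y) i - k i = (x - y) i := by simp; ring
          rwa [e] at h
        push_cast at hn
        omega
      · gcongr
        exact le_self_add
    calc f x = 2⁻¹ * (2 * f x) := by
          rw [← mul_assoc, ENNReal.inv_mul_cancel two_ne_zero (by simp), one_mul]
      _ ≤ 2⁻¹ * 2⁻¹ ^ n := by gcongr
      _ = 2⁻¹ ^ (n + 1) := (pow_succ' _ _).symm

theorem rpow_sum_le_sum_rpow {ι : Type*} (I : Finset ι) (a : ι → ℝ≥0∞) {s : ℝ} (hs0 : 0 < s)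
    (hs1 : s ≤ 1) : (∑ i ∈ I, a i) ^ s ≤ ∑ i ∈ I, a i ^ s := by
  classical
  induction I using Finset.induction_on with
  | empty => simp [hs0]
  | insert i I hi ih =>
    rw [Finset.sum_insert hi, Finset.sum_insert hi]
    exact (ENNReal.rpow_add_le_add_rpow _ _ hs0.le hs1).trans (add_le_add_right ih _)

/-- The potential `lam v`, with `v` truncated to `[-R, R]`. -/
def clipped {d : ℕ} (lam R : ℝ) (v : (Fin d → ℤ) → ℝ) (n : Fin d → ℤ) : ℝ :=
  lam * max (-R) (min (v n) R)

theorem continuous_clipped {d : ℕ} (lam R : ℝ) : Continuous (clipped (d := d) lam R) := by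
  refine continuous_pi fun n => ?_
  unfold clipped
  fun_prop

theorem abs_clipped_le {d : ℕ} {lam R : ℝ} (hlam : 0 < lam) (hR : 0 < R)
    (v : (Fin d → ℤ) → ℝ) (n : Fin d → ℤ) : |clipped lam R v n| ≤ lam * R := by
  rw [clipped, abs_mul, abs_of_pos hlam]
  gcongr
  rw [abs_le]
  exact ⟨le_max_left _ _, max_le (by linarith) (min_le_right _ _)⟩

theorem clipped_apply_of_abs_le {d : ℕ} {lam R : ℝ} {v : (Fin d → ℤ) → ℝ} {n : Fin d → ℤ}
    (h : |v n| ≤ R) : clipped lam R v n = lam * v n := by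
  rw [clipped, min_eq_left (abs_le.1 h).2, max_eq_right (abs_le.1 h).1]

theorem clipped_update {d : ℕ} {lam R : ℝ} (v : (Fin d → ℤ) → ℝ) (x : Fin d → ℤ) {t : ℝ}
    (h : |t| ≤ R) :
    clipped lam R (Function.update v x t) = Function.update (clipped lam R v) x (lam * t) := by
  funext n
  rcases eq_or_ne n x with rfl | hn
  · rw [Function.update_self, clipped_apply_of_abs_le (by simpa using h), Function.update_self]
  · rw [Function.update_of_ne hn, clipped, clipped, Function.update_of_ne hn]

/-! ### Fractional moments of the Green function. -/

section Moments

variable {d : ℕ} {ν : Measure ℝ} [IsProbabilityMeasure ν] {R lam s c : ℝ} {z : ℂ}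

/-- The resolvent is defined by choice, so measurability comes from continuity in the product
topology; the lattice being countable, the Borel and product σ-algebras agree. -/
theorem measurable_greenOf_clipped (hlam : 0 < lam) (hR : 0 < R) (hz : z.im ≠ 0)
    (x y : Fin d → ℤ) : Measurable fun v => greenOf (clipped lam R v) x y z :=
  (continuous_greenOf _ (continuous_clipped lam R) (abs_clipped_le hlam hR) hz x y).measurable

/-- The subharmonicity inequality for the fractional moments of the Green function. -/
theorem lintegral_greenOf_subharmonic (hlam : 0 < lam) (hR : 0 < R)
    (hνR : ∀ᵐ t ∂ν, |t| ≤ R) (hs0 : 0 < s) (hs1 : s < 1)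
    (hdec : ∀ (α : ℝ) (β : ℂ),
      ENNReal.ofReal c * ∫⁻ t, ‖(t : ℂ) - β‖ₑ ^ (-s) ∂ν ≤
        ∫⁻ t, ‖t - α‖ₑ ^ s * ‖(t : ℂ) - β‖ₑ ^ (-s) ∂ν)
    (hz : z.im ≠ 0) (x y : Fin d → ℤ) :
    ENNReal.ofReal c * ENNReal.ofReal lam ^ s *
        ∫⁻ v, ‖greenOf (clipped lam R v) x y z‖ₑ ^ s ∂(Measure.infinitePi fun _ => ν) ≤
      (if x = y then 1 else 0) + ∑ k ∈ unitVectors d,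
        ∫⁻ v, ‖greenOf (clipped lam R v) (x + k) y z‖ₑ ^ s ∂(Measure.infinitePi fun _ => ν) := by
  set μ : Measure ((Fin d → ℤ) → ℝ) := Measure.infinitePi fun _ => ν with hμ
  set L := ENNReal.ofReal c * ENNReal.ofReal lam ^ s
  have hG := fun x => measurable_greenOf_clipped (d := d) hlam hR hz x y
  have hupd : Measurable fun p : ((Fin d → ℤ) → ℝ) × ℝ => Function.update p.1 x p.2 := by
    rw [measurable_pi_iff]
    intro n
    rcases eq_or_ne n x with rfl | hn
    · simpa using measurable_snd
    · simpa [hn, Function.comp_def] using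
        (measurable_pi_apply (X := fun _ : Fin d → ℤ => ℝ) n).comp measurable_fst
  have hresample : ∀ F : ((Fin d → ℤ) → ℝ) → ℝ≥0∞, Measurable F →
      ∫⁻ v, F v ∂μ = ∫⁻ v, ∫⁻ t, F (Function.update v x t) ∂ν ∂μ := fun F hF => by
    nth_rewrite 1 [hμ]
    rw [← map_update_infinitePi ν x, lintegral_map hF hupd, ← hμ]
    exact lintegral_prod _ (hF.comp hupd).aemeasurable
  have hF1 : Measurable fun v => ‖greenOf (clipped lam R v) x y z‖ₑ ^ s :=
    (hG x).enorm.pow_const s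
  have hWx : Measurable fun v : (Fin d → ℤ) → ℝ => clipped lam R v x :=
    (measurable_pi_apply x).comp (continuous_clipped lam R).measurable
  have hF2 : Measurable fun v =>
      ‖(clipped lam R v x : ℂ) - z‖ₑ ^ s * ‖greenOf (clipped lam R v) x y z‖ₑ ^ s :=
    ((((Complex.measurable_ofReal.comp hWx).sub_const z).enorm.pow_const s)).mul hF1
  -- With `v` frozen as reference configuration, `a`, `u` and `w` below do not depend on the
  -- resampled value `t`. The factor `|V(x) - z|^s` is kept inside so that the Green equation can
  -- absorb it.
  have hinner : ∀ v, L * ∫⁻ t, ‖greenOf (clipped lam R (Function.update v x t)) x y z‖ₑ ^ s ∂ν ≤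
      ∫⁻ t, ‖(clipped lam R (Function.update v x t) x : ℂ) - z‖ₑ ^ s *
        ‖greenOf (clipped lam R (Function.update v x t)) x y z‖ₑ ^ s ∂ν := by
    intro v
    have hb := abs_clipped_le hlam hR v
    refine (decoupling_fractional (z := z) hdec hs0 hlam
      (greenOf_self_im_ne_zero hb hz x) (a := clipped lam R v x)
      (u := greenOf (clipped lam R v) x y z) ?_).trans (le_of_eq ?_)
    · filter_upwards [hνR] with t ht
      rw [clipped_update v x ht]
      exact greenOf_update hb hz x y (lam * t)
    · refine lintegral_congr_ae ?_
      filter_upwards [hνR] with t ht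
      rw [clipped_update v x ht, Function.update_self]
  calc L * ∫⁻ v, ‖greenOf (clipped lam R v) x y z‖ₑ ^ s ∂μ
      = ∫⁻ v, L * ∫⁻ t, ‖greenOf (clipped lam R (Function.update v x t)) x y z‖ₑ ^ s ∂ν ∂μ := by
        rw [hresample _ hF1, lintegral_const_mul]
        exact (hF1.comp hupd).lintegral_prod_right'
    _ ≤ ∫⁻ v, ‖(clipped lam R v x : ℂ) - z‖ₑ ^ s *
          ‖greenOf (clipped lam R v) x y z‖ₑ ^ s ∂μ := by
        rw [hresample _ hF2]
        exact lintegral_mono hinner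
    _ ≤ ∫⁻ v, ((if x = y then 1 else 0) +
          ∑ k ∈ unitVectors d, ‖greenOf (clipped lam R v) (x + k) y z‖ₑ ^ s) ∂μ := by
        refine lintegral_mono fun v => ?_
        rw [← ENNReal.mul_rpow_of_nonneg _ _ hs0.le, ← enorm_mul,
          greenOf_equation (abs_clipped_le hlam hR v) hz x y]
        refine (ENNReal.rpow_le_rpow (enorm_add_le _ _) hs0.le).trans ?_
        refine (ENNReal.rpow_add_le_add_rpow _ _ hs0.le hs1.le).trans (add_le_add ?_ ?_)
        · split_ifs <;> simp [hs0]
        · exact (ENNReal.rpow_le_rpow (enorm_sum_le _ _) hs0.le).trans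
            (rpow_sum_le_sum_rpow _ _ hs0 hs1.le)
    _ = _ := by
        rw [lintegral_add_left measurable_const, lintegral_const, measure_univ, mul_one,
          lintegral_finsetSum]
        exact fun k _ => (hG (x + k)).enorm.pow_const s

theorem enorm_greenOf_rpow_le (hlam : 0 < lam) (hR : 0 < R) (hs0 : 0 < s) (hz : z.im ≠ 0)
    (x y : Fin d → ℤ) (v : (Fin d → ℤ) → ℝ) :
    ‖greenOf (clipped lam R v) x y z‖ₑ ^ s ≤ ENNReal.ofReal |z.im|⁻¹ ^ s := by
  refine ENNReal.rpow_le_rpow ?_ hs0.le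
  rw [← ofReal_norm]
  exact ENNReal.ofReal_le_ofReal (norm_greenOf_le (abs_clipped_le hlam hR v) hz x y)

/-- Exponential decay of the fractional moments at large disorder. -/
theorem lintegral_greenOf_le (hlam : 0 < lam) (hR : 0 < R)
    (hνR : ∀ᵐ t ∂ν, |t| ≤ R) (hs0 : 0 < s) (hs1 : s < 1)
    (hdec : ∀ (α : ℝ) (β : ℂ),
      ENNReal.ofReal c * ∫⁻ t, ‖(t : ℂ) - β‖ₑ ^ (-s) ∂ν ≤
        ∫⁻ t, ‖t - α‖ₑ ^ s * ‖(t : ℂ) - β‖ₑ ^ (-s) ∂ν)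
    (hL : 2 * ((unitVectors d).card + 1 : ℝ≥0∞) ≤ ENNReal.ofReal c * ENNReal.ofReal lam ^ s)
    (hz : z.im ≠ 0) (x y : Fin d → ℤ) :
    ∫⁻ v, ‖greenOf (clipped lam R v) x y z‖ₑ ^ s ∂(Measure.infinitePi fun _ => ν) ≤
      2⁻¹ ^ (latticeNorm (x - y)).toNat := by
  have hB : ENNReal.ofReal |z.im|⁻¹ ^ s ≠ ∞ :=
    ENNReal.rpow_ne_top_of_nonneg hs0.le ENNReal.ofReal_ne_top
  have hnn : 0 ≤ latticeNorm (x - y) := Finset.sum_nonneg fun _ _ => abs_nonneg _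
  refine le_pow_of_subharmonic hB (f := fun x =>
    ∫⁻ v, ‖greenOf (clipped lam R v) x y z‖ₑ ^ s ∂(Measure.infinitePi fun _ => ν))
    (fun x => ?_) y (fun x => ?_) _ x (Int.toNat_of_nonneg hnn).le
  · refine (lintegral_mono fun v => enorm_greenOf_rpow_le hlam hR hs0 hz x y v).trans ?_
    simp
  · exact (mul_le_mul_left hL _).trans
      (lintegral_greenOf_subharmonic hlam hR hνR hs0 hs1 hdec hz x y)

end Moments

/-! ### Consequences of the bounded, compactly supported density. -/

section Density

variable {ν : Measure ℝ} {ρ : ℝ → ℝ}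

theorem exists_le_smul_volume (hρ_bdd : MemLp ρ ∞ volume)
    (hν : ν = volume.withDensity fun v => ENNReal.ofReal (ρ v)) :
    ∃ K : ℝ≥0∞, K ≠ ∞ ∧ ν ≤ K • volume := by
  refine ⟨eLpNorm ρ ∞ volume, hρ_bdd.eLpNorm_ne_top, ?_⟩
  rw [hν, ← withDensity_const]
  refine withDensity_mono ?_
  rw [eLpNorm_exponent_top]
  filter_upwards [ae_le_eLpNormEssSup (f := ρ) (μ := volume)] with t ht
  refine le_trans ?_ ht
  rw [Real.enorm_eq_ofReal_abs]
  exact ENNReal.ofReal_le_ofReal (le_abs_self _)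

theorem exists_ae_abs_le (hρ_supp : HasCompactSupport ρ)
    (hν : ν = volume.withDensity fun v => ENNReal.ofReal (ρ v)) :
    ∃ R : ℝ, 0 < R ∧ ∀ᵐ t ∂ν, |t| ≤ R := by
  obtain ⟨R, hR⟩ := hρ_supp.isCompact.isBounded.subset_closedBall (0 : ℝ)
  refine ⟨max R 1, by positivity, ?_⟩
  have hms : MeasurableSet {t : ℝ | |t| ≤ max R 1}ᶜ :=
    (measurableSet_le continuous_abs.measurable measurable_const).compl
  rw [ae_iff, hν]
  change (volume.withDensity _) {t : ℝ | |t| ≤ max R 1}ᶜ = 0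
  rw [withDensity_apply _ hms, setLIntegral_congr_fun (g := fun _ => 0) hms, lintegral_zero]
  intro t ht
  have : t ∉ tsupport ρ := fun h => ht <| by
    have := hR h
    rw [mem_closedBall_zero_iff, Real.norm_eq_abs] at this
    exact this.trans (le_max_left _ _)
  simp [image_eq_zero_of_notMem_tsupport this]

end Density

end Anderson

theorem theorem4p1 (d : ℕ) (hd : 1 ≤ d)
    (ν : Measure ℝ) [IsProbabilityMeasure ν]
    (ρ : ℝ → ℝ) (hρ_nonneg : 0 ≤ᵐ[volume] ρ) (hρ_bdd : MemLp ρ ∞ volume)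
    (hρ_supp : HasCompactSupport ρ)
    (hν : ν = volume.withDensity fun v => ENNReal.ofReal (ρ v))
    (s : ℝ) (hs0 : 0 < s) (hs1 : s < 1) :
    ∃ lam₀ : ℝ, 0 < lam₀ ∧ ∀ lam : ℝ, lam₀ ≤ lam →
      ∃ C m : ℝ, 0 < m ∧
        ∀ (Ω : Type*) [MeasurableSpace Ω] (P : Measure Ω) [IsProbabilityMeasure P]
          (ω : (Fin d → ℤ) → Ω → ℝ),
          (∀ n, Measurable (ω n)) → (∀ n, P.map (ω n) = ν) → iIndepFun ω P →
          ∀ (x y : Fin d → ℤ) (z : ℂ), z.im ≠ 0 →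
            Integrable (fun a => ‖Anderson.green lam (fun n => ω n a) x y z‖ ^ s) P ∧
            ∫ a, ‖Anderson.green lam (fun n => ω n a) x y z‖ ^ s ∂P
              ≤ C * Real.exp (-m * (Anderson.latticeNorm (x - y) : ℝ)) := by
  obtain ⟨K, hK, hνK⟩ := Anderson.exists_le_smul_volume hρ_bdd hν
  obtain ⟨R, hR, hνR⟩ := Anderson.exists_ae_abs_le hρ_supp hν
  obtain ⟨c, hc, hdec⟩ := Anderson.exists_decoupling hK hνK hR hνR hs0 hs1
  set N : ℝ := ((Anderson.unitVectors d).card : ℝ) with hN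
  have hN0 : 0 ≤ N := Nat.cast_nonneg _
  -- This is the value of `lam` at which `c * lam ^ s = 2 * (N + 1)`, the threshold of the
  -- iteration.
  refine ⟨(2 * (N + 1) / c) ^ s⁻¹, by positivity, fun lam hlam₀ => ?_⟩
  have hlam : 0 < lam := lt_of_lt_of_le (by positivity) hlam₀
  have hL : 2 * ((Anderson.unitVectors d).card + 1 : ℝ≥0∞) ≤
      ENNReal.ofReal c * ENNReal.ofReal lam ^ s := by
    have h1 : 2 * (N + 1) ≤ c * lam ^ s := by
      have h := Real.rpow_le_rpow (by positivity) hlam₀ hs0.le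
      rw [← Real.rpow_mul (by positivity), inv_mul_cancel₀ hs0.ne', Real.rpow_one,
        div_le_iff₀ hc] at h
      linarith
    have h2 := ENNReal.ofReal_le_ofReal h1
    rw [ENNReal.ofReal_mul two_pos.le, ENNReal.ofReal_ofNat, ENNReal.ofReal_add hN0 one_pos.le,
      hN, ENNReal.ofReal_natCast, ENNReal.ofReal_one, ENNReal.ofReal_mul hc.le,
      ← ENNReal.ofReal_rpow_of_pos hlam] at h2
    exact h2
  -- The bound `2^{-|x-y|}` written as an exponential.
  refine ⟨1, Real.log 2, Real.log_pos one_lt_two, ?_⟩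
  intro Ω _ P _ ω hω hlaw hind x y z hz
  have hω' : Measurable fun a n => ω n a := measurable_pi_lambda _ hω
  have hmap : P.map (fun a n => ω n a) = Measure.infinitePi fun _ => ν := by
    rw [(iIndepFun_iff_map_fun_eq_infinitePi_map hω).1 hind]
    simp_rw [hlaw]
  -- Countably many almost sure bounds hold simultaneously, so truncation almost surely changes
  -- nothing. This also supplies the a.e. measurability of `green`.
  have hae : ∀ᵐ a ∂P, Anderson.green lam (fun n => ω n a) x y z =
      Anderson.greenOf (Anderson.clipped lam R fun n => ω n a) x y z := by
    have hb : ∀ᵐ a ∂P, ∀ n, |ω n a| ≤ R := ae_all_iff.2 fun n => by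
      have h := hνR
      rw [← hlaw n] at h
      exact ae_of_ae_map (hω n).aemeasurable h
    filter_upwards [hb] with a ha
    rw [Anderson.green_eq_greenOf]
    congr 1
    funext n
    exact (Anderson.clipped_apply_of_abs_le (v := fun n => ω n a) (ha n)).symm
  have hGm : Measurable fun a =>
      Anderson.greenOf (Anderson.clipped lam R fun n => ω n a) x y z :=
    (Anderson.measurable_greenOf_clipped hlam hR hz x y).comp hω'
  have hpt : ∀ w : ℂ, ENNReal.ofReal (‖w‖ ^ s) = ‖w‖ₑ ^ s := fun w => by
    rw [← ofReal_norm, ENNReal.ofReal_rpow_of_nonneg (norm_nonneg _) hs0.le]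
  have hbound : ∫⁻ a, ENNReal.ofReal (‖Anderson.green lam (fun n => ω n a) x y z‖ ^ s) ∂P ≤
      2⁻¹ ^ (Anderson.latticeNorm (x - y)).toNat := by
    refine le_trans (le_of_eq ?_)
      (Anderson.lintegral_greenOf_le (d := d) hlam hR hνR hs0 hs1 hdec hL hz x y)
    rw [← hmap, lintegral_map
      ((Anderson.measurable_greenOf_clipped hlam hR hz x y).enorm.pow_const s) hω']
    refine lintegral_congr_ae ?_
    filter_upwards [hae] with a ha
    rw [hpt, ha]
  have hmeas : AEStronglyMeasurable
      (fun a => ‖Anderson.green lam (fun n => ω n a) x y z‖ ^ s) P := by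
    refine ((hGm.norm.pow_const s).aestronglyMeasurable).congr ?_
    filter_upwards [hae] with a ha
    rw [ha]
  have hnn : ∀ a, 0 ≤ ‖Anderson.green lam (fun n => ω n a) x y z‖ ^ s :=
    fun a => Real.rpow_nonneg (norm_nonneg _) _
  have hpow : (2⁻¹ : ℝ≥0∞) ^ (Anderson.latticeNorm (x - y)).toNat ≠ ∞ :=
    ENNReal.pow_ne_top (by simp)
  refine ⟨⟨hmeas, ?_⟩, ?_⟩
  · rw [hasFiniteIntegral_iff_ofReal (Filter.Eventually.of_forall hnn)]
    exact hbound.trans_lt hpow.lt_top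
  · rw [integral_eq_lintegral_of_nonneg_ae (Filter.Eventually.of_forall hnn) hmeas, one_mul]
    refine (ENNReal.toReal_mono hpow hbound).trans (le_of_eq ?_)
    have hnonneg : 0 ≤ Anderson.latticeNorm (x - y) := Finset.sum_nonneg fun _ _ => abs_nonneg _
    have hcast : ((Anderson.latticeNorm (x - y) : ℤ) : ℝ) =
        ((Anderson.latticeNorm (x - y)).toNat : ℝ) := by
      exact_mod_cast (Int.toNat_of_nonneg hnonneg).symm
    rw [hcast, ENNReal.toReal_pow, ENNReal.toReal_inv, ENNReal.toReal_ofNat, mul_comm,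
      Real.exp_nat_mul, Real.exp_neg, Real.exp_log two_pos]
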